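/- **Setting.** An episodic MDP has finite state and action spaces $\mathcal S,\mathcal A$, horizon $H$, deterministic rewards $r_h:\mathcal S\times\mathcal A\to[0,1]$ and transition kernels $\mathbb P_h(\cdot\mid s,a)$, $h\in[H]$. It is a *linear mixture* MDP of dimension $d$ if there is a feature map $\phi:\mathcal S\times\mathcal S\times\mathcal A\to\mathbb R^d$ with $\big\|\sum_{s'}f(s')\phi(s',s,a)\big\|_2\le 1$ for all $f:\mathcal S\to[0,1]$ and all $(s,a)$, and for every $h$ a vector $\theta_h\in\mathbb R^d$ with $\|\theta_h\|_2\le\sqrt d$ and $\mathbb P_h(s'\mid s,a)=\langle\theta_h,\phi(s',s,a)\rangle$ for all $s',s,a$. For a risk level $\alpha\in(0,1]$ let $\mathrm{CVaR}^\alpha(X)=\sup_{x\in\mathbb R}\{x-\frac1\alpha\mathbb E[(x-X)^+]\}$. For a deterministic policy $\pi=(\pi_h:\mathcal S\to\mathcal A)_{h\in[H]}$ let $V^\pi_{H+1}=0$, $V_h^\pi(s)=r_h(s,\pi_h(s))+\mathrm{CVaR}^\alpha_{s'\sim\mathbb P_h(\cdot\mid s,\pi_h(s))}(V_{h+1}^\pi(s'))$,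 and $V_1^*(s)=\max_\pi V_1^\pi(s)$. An algorithm knows $\mathcal S,\mathcal A,\phi,r,H,K,\alpha$ and the initial states $s_{k,1}$, but not the kernels; in each episode $k\in[K]$ it chooses, possibly at random, a policy $\pi^k$ on the basis of the policies and the visited states of the earlier episodes, and $\pi^k$ is then executed from $s_{k,1}$. Its regret is $\mathrm{Regret}(K)=\sum_{k=1}^K\big(V_1^*(s_{k,1})-V_1^{\pi^k}(s_{k,1})\big)$. **Theorem.** There is a universal constant $c>0$ such that the following holds. Let $H\ge2$, $d\ge2$, $n\in[H-1]$, $\alpha\in(0,1]$ and $K\ge d^2/\alpha^n$. Then for any algorithm there is a linear mixture MDP of dimension $d$ and horizon $H$ on which $$\mathbb E[\mathrm{Regret}(K)]\ \ge\ c\,d\,(H-n)\sqrt{\frac{K}{\alpha^{n}}}.$$ The MDP can be taken of the following form. Its states are $s_1,\dots,s_n,x_1,x_2,x_3$, its actions are the sign vectors $a\in\{-1,1\}^{d-1}$, and every episode starts in $s_1$. At every step the reward is $0$ in $s_1,\dots,s_n$ and $1$, $0.8$, $0.2$ in $x_1,x_2,x_3$. At every step and under every action, $s_i$ with $i<n$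 moves to $s_{i+1}$ with probability $\alpha$ and to $x_1$ with probability $1-\alpha$, and $x_1,x_2,x_3$ are absorbing. From $s_n$, action $a$ leads to $x_3$ with probability $q-\langle\mu,a\rangle$ and to $x_2$ otherwise, where $\mu\in\{-\Delta,\Delta\}^{d-1}$, $\Delta>0$ and $q+(d-1)\Delta\le\alpha$. (For $n=H-1$ the right-hand side is $c\sqrt{\alpha^{-(H-1)}d^2K}$.) -/

import Mathlib

/-! Iterated CVaR reinforcement learning in episodic linear mixture MDPs. Steps are numbered from
`0`, so that `h : Fin H` stands for step `h + 1` of an episode of length `H`, and episodes are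
numbered from `0` as well. -/

noncomputable section

namespace ICVaR

/-- Conditional value at risk at level `α` of `X` under `p`:
`sup_x { x - (1 / α) * 𝔼[(x - X)⁺] }`. For `0 < α ≤ 1` the set is bounded above. -/
def cvar {S : Type} [Fintype S] (α : ℝ) (p : PMF S) (X : S → ℝ) : ℝ :=
  ⨆ x : ℝ, (x - 1 / α * ∑ s, (p s).toReal * max (x - X s) 0)

/-- Everything that the agent is told about the problem: the (finite) state and action spaces,
the `d`-dimensional feature basis, the reward functions and the initial states of the episodes.
The feature basis is normalised: `‖∑ s', f s' • feature s' s a‖ ≤ 1` for all `f` with values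
in `[0, 1]`. -/
structure Task (d H : ℕ) where
  State : Type
  Action : Type
  [fintypeState : Fintype State]
  [decEqState : DecidableEq State]
  [fintypeAction : Fintype Action]
  [decEqAction : DecidableEq Action]
  [nonemptyAction : Nonempty Action]
  /-- `feature s' s a` belongs to the transition from `s` to `s'` under `a`. -/
  feature : State → State → Action → EuclideanSpace ℝ (Fin d)
  feature_norm_le : ∀ f : State → ℝ, (∀ s, f s ∈ Set.Icc (0 : ℝ) 1) →
    ∀ s a, ‖∑ s', f s' • feature s' s a‖ ≤ 1
  reward : Fin H → State → Action → ℝ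
  reward_mem : ∀ h s a, reward h s a ∈ Set.Icc (0 : ℝ) 1
  /-- `init k` is the initial state of episode `k`. -/
  init : ℕ → State

attribute [instance] Task.fintypeState Task.decEqState Task.fintypeAction Task.decEqAction
  Task.nonemptyAction

namespace Task

variable {d H : ℕ} (T : Task d H)

/-- Transition kernels, one for each step. They are unknown to the agent. -/
abbrev Kernels : Type := Fin H → T.State → T.Action → PMF T.State

/-- The kernel of every step is a linear mixture of the feature basis. -/
def IsLinearMixture (P : T.Kernels) : Prop :=
  ∀ h, ∃ θ : EuclideanSpace ℝ (Fin d), ‖θ‖ ≤ √(d : ℝ) ∧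
    ∀ s' s a, (P h s a s').toReal = inner ℝ θ (T.feature s' s a)

/-- Deterministic policies `π = (π_h)`. -/
abbrev Policy : Type := Fin H → T.State → T.Action

/-- The value functions of `π` under the iterated CVaR criterion: `V_{H+1} = 0` and
`V_h s = r_h (s, π_h s) + CVaR_{s' ∼ P_h (s, π_h s)} (V_{h+1} s')`. -/
def value (α : ℝ) (P : T.Kernels) (π : T.Policy) (h : Fin (H + 1)) : T.State → ℝ :=
  Fin.reverseInduction (motive := fun _ => T.State → ℝ)
    (fun _ => 0)
    (fun h V s => T.reward h s (π h s) + cvar α (P h s (π h s)) V) h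

/-- The optimal value `V_1^* s = max_π V_1^π s` (a maximum over a finite nonempty set). -/
def optValue (α : ℝ) (P : T.Kernels) (s : T.State) : ℝ :=
  ⨆ π : T.Policy, T.value α P π 0 s

/-- What is observed in an episode: the policy that was executed and the `H + 1` visited states.
They determine the actions and the rewards. -/
abbrev Episode : Type := T.Policy × (Fin (H + 1) → T.State)

/-- A (possibly randomised) learner: the distribution of the policy of episode `k`, given the `k`
earlier episodes. -/
abbrev Learner : Type := (k : ℕ) → (Fin k → T.Episode) → PMF T.Policy

/-- The law of the first `m + 1` states of an episode that starts in `s₀` and follows `π`. -/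
def rollout (P : T.Kernels) (π : T.Policy) (s₀ : T.State) :
    (m : ℕ) → m ≤ H → PMF (Fin (m + 1) → T.State)
  | 0, _ => PMF.pure fun _ => s₀
  | m + 1, hm => (rollout P π s₀ m (Nat.le_of_succ_le hm)).bind fun τ =>
      (P ⟨m, hm⟩ (τ (Fin.last m)) (π ⟨m, hm⟩ (τ (Fin.last m)))).map fun s' =>
        Fin.snoc (α := fun _ => T.State) τ s'

/-- The joint law of the first `k` episodes when the learner `L` interacts with `P`. -/
def law (P : T.Kernels) (L : T.Learner) : (k : ℕ) → PMF (Fin k → T.Episode)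
  | 0 => PMF.pure Fin.elim0
  | k + 1 => (law P L k).bind fun hist => (L k hist).bind fun π =>
      (T.rollout P π (T.init k) H le_rfl).map fun τ =>
        Fin.snoc (α := fun _ => T.Episode) hist (π, τ)

/-- `Regret(K) = ∑_k (V_1^* (s_{k,1}) - V_1^{π^k} (s_{k,1}))` along a realisation. -/
def regret (α : ℝ) (P : T.Kernels) {K : ℕ} (ω : Fin K → T.Episode) : ℝ :=
  ∑ k : Fin K, (T.optValue α P (T.init k) - T.value α P (ω k).1 0 (T.init k))

/-- `𝔼[Regret(K)]`, over the transitions and the learner's randomisation. -/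
def expectedRegret (α : ℝ) (P : T.Kernels) (L : T.Learner) (K : ℕ) : ℝ :=
  ∑ ω : Fin K → T.Episode, (T.law P L K ω).toReal * T.regret α P ω

/-- The shape of the hard instances: a chain of `n` states that is followed from one state to the
next with probability `α`, and at its end a bandit whose actions are the sign vectors of
length `d - 1`. -/
structure ChainBandit (P : T.Kernels) (n : ℕ) (α : ℝ) where
  /-- The regular states `s_1, …, s_n`. -/
  chain : Fin n → T.State
  /-- The absorbing states `x_1, x_2, x_3`. -/
  absorb : Fin 3 → T.State
  bijective_states : Function.Bijective (Sum.elim chain absorb)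
  /-- The actions are the sign vectors in `{-1, 1}^(d-1)`. -/
  sign : T.Action ≃ (Fin (d - 1) → ℤˣ)
  Δ : ℝ
  Δ_pos : 0 < Δ
  /-- The hidden vector in `{-Δ, Δ}^(d-1)`. -/
  μ : Fin (d - 1) → ℝ
  μ_eq : ∀ i, μ i = Δ ∨ μ i = -Δ
  /-- The base probability of the bad state `x_3`. -/
  q : ℝ
  q_le : q + ((d : ℝ) - 1) * Δ ≤ α
  init_eq : ∀ k (i : Fin n), (i : ℕ) = 0 → T.init k = chain i
  reward_chain : ∀ h i a, T.reward h (chain i) a = 0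
  reward_absorb : ∀ h a, T.reward h (absorb 0) a = 1 ∧ T.reward h (absorb 1) a = 0.8 ∧
    T.reward h (absorb 2) a = 0.2
  trans_chain : ∀ h a (i j : Fin n), (j : ℕ) = i + 1 →
    (P h (chain i) a (chain j)).toReal = α ∧ (P h (chain i) a (absorb 0)).toReal = 1 - α
  trans_last : ∀ h a (i : Fin n), (i : ℕ) + 1 = n →
    (P h (chain i) a (absorb 2)).toReal = q - ∑ j, μ j * ((sign a j : ℤ) : ℝ) ∧
    (P h (chain i) a (absorb 1)).toReal = 1 - (q - ∑ j, μ j * ((sign a j : ℤ) : ℝ))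
  trans_absorb : ∀ h a i, (P h (absorb i) a (absorb i)).toReal = 1

end Task

/-- An algorithm picks a learner for every task, knowing all the data of the task. -/
abbrev Algorithm (d H : ℕ) : Type 1 := (T : Task d H) → T.Learner

end ICVaR

end

noncomputable section

namespace ICVaR

open Finset

/-! ### The Bhattacharyya coefficient of two distributions on a finite type -/

/-! Iterated CVaR does not discount an event of probability `α`. When the worse of two successors
has probability `p ≤ α`, the CVaR is `V y - p / α * (V y - V x)` (`cvar_twoPoint`). Along the chain
`p = α`, so the value of the end of the chain is passed back undiminished, although an episode gets
there only with probability `α ^ (n - 1)`. At the end, a hidden vector with entries `±Δ` shifts the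
probability of the bad state, and each wrong sign costs `2 * 0.6 * (H - n) * Δ / α`
(`chainValue_chain`, `chain_regret_ge`).

Learning a sign is slow. Two hidden vectors that differ in one sign differ only at the end of the
chain, where the bad probabilities are of order `α` and differ by `2 * Δ`. One episode therefore has
Bhattacharyya affinity at least `1 - (4 * Δ ^ 2 / α) * α ^ (n - 1)` (`chainAffinity_one_ge`).
Affinities multiply over episodes even for an adaptive learner, since its own choices have the same
conditional law under both instances (`pow_le_bhatt_law`). With `Δ = α / (4 * √(K * α ^ n))` the
affinity of all `K` episodes stays at least `3 / 4`.

Le Cam's bound for each coordinate, averaged over all hidden vectors as in Assouad's lemma, yields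
one vector for which at least `K * (d - 1) / 8` signs are wrong in expectation
(`exists_many_wrongSigns`). Multiplying by the cost of a wrong sign gives the rate. -/

lemma sum_toReal_pmf {S : Type} [Fintype S] (p : PMF S) : ∑ s, (p s).toReal = 1 := by
  rw [← ENNReal.toReal_sum fun s _ => p.apply_ne_top s]
  have h := p.tsum_coe
  rw [tsum_fintype] at h
  simp [h]

/-- The Bhattacharyya coefficient `∑ √(p s) √(q s)`. -/
def bhatt {S : Type} [Fintype S] (p q : PMF S) : ℝ :=
  ∑ s, √(p s).toReal * √(q s).toReal

lemma bhatt_nonneg {S : Type} [Fintype S] (p q : PMF S) : 0 ≤ bhatt p q :=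
  sum_nonneg fun _ _ => by positivity

lemma bhatt_self {S : Type} [Fintype S] (p : PMF S) : bhatt p p = 1 := by
  rw [bhatt, ← sum_toReal_pmf p]
  exact sum_congr rfl fun s _ => Real.mul_self_sqrt ENNReal.toReal_nonneg

/-- The probability of a point under a joint law that is built from a marginal and a kernel. -/
lemma bind_map_apply {A B C : Type} [Fintype A] (f : A → B → C)
    (hf : Function.Injective fun x : A × B => f x.1 x.2) (p : PMF A) (κ : A → PMF B)
    (a : A) (b : B) :
    (p.bind fun a => (κ a).map (f a)) (f a b) = p a * κ a b := by
  classical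
  rw [PMF.bind_apply, tsum_eq_single a]
  · congr 1
    rw [PMF.map_apply, tsum_eq_single b]
    · simp
    · intro b' hb'
      rw [if_neg]
      intro h
      exact hb' (congrArg Prod.snd (@hf (a, b) (a, b') h)).symm
  · intro a' ha'
    rw [PMF.map_apply]
    have : ∀ b', (if f a b = f a' b' then (κ a') b' else 0) = 0 := by
      intro b'
      rw [if_neg]
      intro h
      exact ha' (congrArg Prod.fst (@hf (a, b) (a', b') h)).symm
    simp [this]

/-- The affinity of two joint laws, integrated against a function. -/
lemma sum_sqrt_bind_map {A B C : Type} [Fintype A] [Fintype B] [Fintype C] (f : A → B → C)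
    (hf : Function.Bijective fun x : A × B => f x.1 x.2) (p q : PMF A) (κ ι : A → PMF B)
    (F : C → ℝ) :
    ∑ c, √((p.bind fun a => (κ a).map (f a)) c).toReal *
        √((q.bind fun a => (ι a).map (f a)) c).toReal * F c =
      ∑ a, √(p a).toReal * √(q a).toReal *
        ∑ b, √(κ a b).toReal * √(ι a b).toReal * F (f a b) := by
  rw [← Function.Bijective.sum_comp hf, Fintype.sum_prod_type]
  refine sum_congr rfl fun a _ => ?_
  rw [mul_sum]
  refine sum_congr rfl fun b _ => ?_
  simp only
  rw [bind_map_apply f hf.1, bind_map_apply f hf.1, ENNReal.toReal_mul, ENNReal.toReal_mul,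
    Real.sqrt_mul ENNReal.toReal_nonneg, Real.sqrt_mul ENNReal.toReal_nonneg]
  ring

/-- Chain rule: square roots of densities factor, so conditional affinities are summed with the
weights `√p * √q` of the marginals. -/
lemma bhatt_bind_map {A B C : Type} [Fintype A] [Fintype B] [Fintype C] (f : A → B → C)
    (hf : Function.Bijective fun x : A × B => f x.1 x.2) (p q : PMF A) (κ ι : A → PMF B) :
    bhatt (p.bind fun a => (κ a).map (f a)) (q.bind fun a => (ι a).map (f a)) =
      ∑ a, √(p a).toReal * √(q a).toReal * bhatt (κ a) (ι a) := by
  simpa [bhatt] using sum_sqrt_bind_map f hf p q κ ι fun _ => 1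

lemma bijective_snoc (k : ℕ) (E : Type) :
    Function.Bijective fun x : (Fin k → E) × E => Fin.snoc (α := fun _ => E) x.1 x.2 := by
  constructor
  · rintro ⟨a, b⟩ ⟨a', b'⟩ h
    have h' := Fin.snoc_inj.1 h
    exact Prod.ext h'.1 h'.2
  · intro w
    exact ⟨(Fin.init w, w (Fin.last k)), Fin.snoc_init_self w⟩

/-- Le Cam's two point bound in terms of the Bhattacharyya coefficient. -/
lemma two_point_bound {S : Type} [Fintype S] (p q : PMF S) (f : S → ℝ) (B : ℝ)
    (hf : ∀ s, f s ∈ Set.Icc 0 B) (hB : 0 ≤ B) :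
    B / 2 * bhatt p q ^ 2 ≤
      ∑ s, (p s).toReal * f s + ∑ s, (q s).toReal * (B - f s) := by
  -- Since `p * q = min * max` pointwise, Cauchy–Schwarz bounds the squared affinity by the mass of
  -- the minimum times that of the maximum, and the latter is at most `2`.
  set u : S → ℝ := fun s => min (p s).toReal (q s).toReal
  set v : S → ℝ := fun s => max (p s).toReal (q s).toReal
  have hu : ∀ s, 0 ≤ u s := fun s => le_min ENNReal.toReal_nonneg ENNReal.toReal_nonneg
  have hv : ∀ s, 0 ≤ v s := fun s => le_max_of_le_left ENNReal.toReal_nonneg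
  have hb : bhatt p q = ∑ s, √(u s) * √(v s) := by
    refine sum_congr rfl fun s _ => ?_
    rw [← Real.sqrt_mul ENNReal.toReal_nonneg, ← Real.sqrt_mul (hu s), min_mul_max]
  have hcs : bhatt p q ^ 2 ≤ (∑ s, u s) * ∑ s, v s := by
    have h := Real.sum_sqrt_mul_sqrt_le univ hu hv
    rw [← hb] at h
    calc bhatt p q ^ 2 ≤ (√(∑ s, u s) * √(∑ s, v s)) ^ 2 := by
          gcongr
          exact bhatt_nonneg p q
      _ = _ := by
          rw [mul_pow, Real.sq_sqrt (sum_nonneg fun s _ => hu s),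
            Real.sq_sqrt (sum_nonneg fun s _ => hv s)]
  have hv2 : ∑ s, v s ≤ 2 := by
    calc ∑ s, v s ≤ ∑ s, ((p s).toReal + (q s).toReal) :=
          sum_le_sum fun s _ => max_le_add_of_nonneg ENNReal.toReal_nonneg ENNReal.toReal_nonneg
      _ = 2 := by rw [sum_add_distrib, sum_toReal_pmf, sum_toReal_pmf]; norm_num
  have hmin : B * ∑ s, u s ≤
      ∑ s, (p s).toReal * f s + ∑ s, (q s).toReal * (B - f s) := by
    rw [mul_sum, ← sum_add_distrib]
    refine sum_le_sum fun s _ => ?_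
    have h1 : u s * f s ≤ (p s).toReal * f s :=
      mul_le_mul_of_nonneg_right (min_le_left _ _) (hf s).1
    have h2 : u s * (B - f s) ≤ (q s).toReal * (B - f s) :=
      mul_le_mul_of_nonneg_right (min_le_right _ _) (by linarith [(hf s).2])
    linarith
  have h0 : 0 ≤ ∑ s, u s := sum_nonneg fun s _ => hu s
  nlinarith [mul_le_mul_of_nonneg_left hv2 h0]

/-! ### Distributions on two points -/

/-- The distribution that charges `x` with `p` and `y` with `1 - p`. -/
def twoPoint {S : Type} [Fintype S] [DecidableEq S] (p : ℝ) (hp : p ∈ Set.Icc (0 : ℝ) 1)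
    (x y : S) : PMF S :=
  PMF.ofFintype
    (fun s => ENNReal.ofReal ((if s = x then p else 0) + (if s = y then 1 - p else 0))) <| by
    have h1 := hp.1
    have h2 : 0 ≤ 1 - p := by linarith [hp.2]
    rw [← ENNReal.ofReal_sum_of_nonneg]
    · simp [sum_add_distrib]
    · intro s _
      split_ifs <;> linarith

lemma twoPoint_toReal {S : Type} [Fintype S] [DecidableEq S] {p : ℝ}
    (hp : p ∈ Set.Icc (0 : ℝ) 1) (x y s : S) :
    (twoPoint p hp x y s).toReal = (if s = x then p else 0) + (if s = y then 1 - p else 0) := by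
  have h1 := hp.1
  have h2 : 0 ≤ 1 - p := by linarith [hp.2]
  rw [twoPoint, PMF.ofFintype_apply, ENNReal.toReal_ofReal]
  split_ifs <;> linarith

lemma sum_twoPoint {S : Type} [Fintype S] [DecidableEq S] {p : ℝ}
    (hp : p ∈ Set.Icc (0 : ℝ) 1) (x y : S) (F : S → ℝ) :
    ∑ s, (twoPoint p hp x y s).toReal * F s = p * F x + (1 - p) * F y := by
  simp [twoPoint_toReal, add_mul, sum_add_distrib]

/-- The supremum is attained at `V y`: below it the objective is dominated by a function of slope `1
- p / α ≥ 0`, above it the slope is `1 - 1 / α ≤ 0`. -/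
lemma cvar_twoPoint {S : Type} [Fintype S] [DecidableEq S] {α p : ℝ} (hα : 0 < α) (hα1 : α ≤ 1)
    (hp : p ∈ Set.Icc (0 : ℝ) 1) (hpα : p ≤ α) (x y : S) (V : S → ℝ) (hV : V x ≤ V y) :
    cvar α (twoPoint p hp x y) V = V y - p / α * (V y - V x) := by
  have hp0 := hp.1
  have hp1 := hp.2
  unfold cvar
  simp only [sum_twoPoint hp]
  have hα' : 0 < 1 / α := by positivity
  have hub : ∀ t : ℝ, t - 1 / α * (p * max (t - V x) 0 + (1 - p) * max (t - V y) 0) ≤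
      V y - p / α * (V y - V x) := by
    intro t
    have hx : t - V x ≤ max (t - V x) 0 := le_max_left _ _
    have hx0 : 0 ≤ max (t - V y) 0 := le_max_right _ _
    rw [← sub_nonneg]
    have key : α * t - (p * max (t - V x) 0 + (1 - p) * max (t - V y) 0) ≤
        α * V y - p * (V y - V x) := by
      rcases le_total t (V y) with h | h
      · nlinarith [mul_le_mul_of_nonneg_left hx hp0, mul_nonneg (sub_nonneg.2 hp1) hx0,
          mul_nonneg (sub_nonneg.2 hpα) (sub_nonneg.2 h)]
      · rw [max_eq_left (by linarith), max_eq_left (by linarith)]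
        nlinarith [mul_nonneg (sub_nonneg.2 hα1) (sub_nonneg.2 h)]
    have := mul_le_mul_of_nonneg_left key hα'.le
    have e1 : V y - p / α * (V y - V x) = 1 / α * (α * V y - p * (V y - V x)) := by
      field_simp
    have e2 : t - 1 / α * (p * max (t - V x) 0 + (1 - p) * max (t - V y) 0) =
        1 / α * (α * t - (p * max (t - V x) 0 + (1 - p) * max (t - V y) 0)) := by
      field_simp
    rw [e1, e2]
    linarith
  apply le_antisymm (ciSup_le hub)
  refine le_ciSup_of_le ⟨_, by rintro _ ⟨t, rfl⟩; exact hub t⟩ (V y) ?_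
  rw [max_eq_left (by linarith), sub_self, max_self]
  apply le_of_eq
  field_simp
  ring

/-- `√x * √y` is the arithmetic mean minus `(√x - √y) ^ 2 / 2`, and `x - y = (√x - √y) * (√x + √y)`
with `(√x + √y) ^ 2 ≥ 4 * c`. -/
lemma sqrt_mul_sqrt_ge {x y c : ℝ} (hc : 0 < c) (hx : c ≤ x) (hy : c ≤ y) :
    (x + y) / 2 - (x - y) ^ 2 / (8 * c) ≤ √x * √y := by
  have hx' := Real.sq_sqrt (hc.le.trans hx)
  have hy' := Real.sq_sqrt (hc.le.trans hy)
  have hcc := Real.sq_sqrt hc.le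
  have h1 : √c ≤ √x := Real.sqrt_le_sqrt hx
  have h2 : √c ≤ √y := Real.sqrt_le_sqrt hy
  have h0 := Real.sqrt_nonneg c
  have hs : 4 * c ≤ (√x + √y) ^ 2 := by nlinarith
  have e : (x - y) ^ 2 = (√x - √y) ^ 2 * (√x + √y) ^ 2 := by
    rw [← hx', ← hy', Real.sqrt_sq (Real.sqrt_nonneg x), Real.sqrt_sq (Real.sqrt_nonneg y)]
    ring
  have : (√x - √y) ^ 2 / 2 ≤ (x - y) ^ 2 / (8 * c) := by
    rw [e, div_le_div_iff₀ two_pos (by positivity)]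
    nlinarith [mul_le_mul_of_nonneg_left hs (sq_nonneg (√x - √y))]
  nlinarith

lemma bhatt_twoPoint_ge {S : Type} [Fintype S] [DecidableEq S] {p q c : ℝ}
    (hp : p ∈ Set.Icc (0 : ℝ) 1) (hq : q ∈ Set.Icc (0 : ℝ) 1) (hc : 0 < c)
    (hcp : p ∈ Set.Icc c (1 - c)) (hcq : q ∈ Set.Icc c (1 - c)) {x y : S} (hxy : x ≠ y) :
    1 - (p - q) ^ 2 / (4 * c) ≤ bhatt (twoPoint p hp x y) (twoPoint q hq x y) := by
  have h1 := sqrt_mul_sqrt_ge hc hcp.1 hcq.1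
  have h2 := sqrt_mul_sqrt_ge hc (x := 1 - p) (y := 1 - q) (by linarith [hcp.2])
    (by linarith [hcq.2])
  have h3 : √p * √q + √(1 - p) * √(1 - q) ≤
      bhatt (twoPoint p hp x y) (twoPoint q hq x y) := by
    have := sum_le_univ_sum_of_nonneg (s := {x, y})
      (f := fun s => √(twoPoint p hp x y s).toReal * √(twoPoint q hq x y s).toReal)
      (fun s => by positivity)
    rw [sum_pair hxy] at this
    simpa [bhatt, twoPoint_toReal, hxy, hxy.symm] using this
  have e : (p - q) ^ 2 / (4 * c) = (p - q) ^ 2 / (8 * c) + (1 - p - (1 - q)) ^ 2 / (8 * c) := by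
    field_simp
    ring
  linarith

namespace Task

variable {d H : ℕ} (T : Task d H)

/-! ### Affinity of episodes and of interaction histories -/

/-- The affinity of the rollouts under two kernels, integrated against a function of the last
state. -/
def rolloutAffinity (P Q : T.Kernels) (π : T.Policy) (s₀ : T.State) (m : ℕ) (hm : m ≤ H)
    (F : T.State → ℝ) : ℝ :=
  ∑ τ, √(T.rollout P π s₀ m hm τ).toReal * √(T.rollout Q π s₀ m hm τ).toReal * F (τ (Fin.last m))

lemma rolloutAffinity_zero (P Q : T.Kernels) (π : T.Policy) (s₀ : T.State) (F : T.State → ℝ) :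
    T.rolloutAffinity P Q π s₀ 0 (Nat.zero_le H) F = F s₀ := by
  rw [rolloutAffinity, sum_eq_single fun _ => s₀]
  · simp [rollout]
  · intro τ _ hτ
    simp [rollout, hτ]
  · simp

lemma rolloutAffinity_succ (P Q : T.Kernels) (π : T.Policy) (s₀ : T.State) (m : ℕ)
    (hm : m + 1 ≤ H) (F : T.State → ℝ) :
    T.rolloutAffinity P Q π s₀ (m + 1) hm F =
      T.rolloutAffinity P Q π s₀ m (Nat.le_of_succ_le hm) fun s =>
        ∑ s', √(P ⟨m, hm⟩ s (π ⟨m, hm⟩ s) s').toReal * √(Q ⟨m, hm⟩ s (π ⟨m, hm⟩ s) s').toReal *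
          F s' := by
  rw [rolloutAffinity, rolloutAffinity]
  have h := sum_sqrt_bind_map
    (fun (τ : Fin (m + 1) → T.State) s' => Fin.snoc (α := fun _ => T.State) τ s')
    (bijective_snoc (m + 1) T.State)
    (T.rollout P π s₀ m (Nat.le_of_succ_le hm)) (T.rollout Q π s₀ m (Nat.le_of_succ_le hm))
    (fun τ => P ⟨m, hm⟩ (τ (Fin.last m)) (π ⟨m, hm⟩ (τ (Fin.last m))))
    (fun τ => Q ⟨m, hm⟩ (τ (Fin.last m)) (π ⟨m, hm⟩ (τ (Fin.last m))))
    (fun τ => F (τ (Fin.last (m + 1))))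
  simp only [Fin.snoc_last] at h
  exact h

lemma rolloutAffinity_mono (P Q : T.Kernels) (π : T.Policy) (s₀ : T.State) (m : ℕ) (hm : m ≤ H)
    {F G : T.State → ℝ} (h : ∀ s, F s ≤ G s) :
    T.rolloutAffinity P Q π s₀ m hm F ≤ T.rolloutAffinity P Q π s₀ m hm G :=
  sum_le_sum fun τ _ => mul_le_mul_of_nonneg_left (h _) (by positivity)

lemma rolloutAffinity_one (P Q : T.Kernels) (π : T.Policy) (s₀ : T.State) (m : ℕ) (hm : m ≤ H) :
    T.rolloutAffinity P Q π s₀ m hm (fun _ => 1) =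
      bhatt (T.rollout P π s₀ m hm) (T.rollout Q π s₀ m hm) := by
  simp [rolloutAffinity, bhatt]

lemma rolloutAffinity_mul (P Q : T.Kernels) (π : T.Policy) (s₀ : T.State) (m : ℕ) (hm : m ≤ H)
    (c : ℝ) (F : T.State → ℝ) :
    T.rolloutAffinity P Q π s₀ m hm (fun s => c * F s) =
      c * T.rolloutAffinity P Q π s₀ m hm F := by
  rw [rolloutAffinity, rolloutAffinity, mul_sum]
  exact sum_congr rfl fun τ _ => by ring

lemma rolloutAffinity_sub (P Q : T.Kernels) (π : T.Policy) (s₀ : T.State) (m : ℕ) (hm : m ≤ H)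
    (F G : T.State → ℝ) :
    T.rolloutAffinity P Q π s₀ m hm (fun s => F s - G s) =
      T.rolloutAffinity P Q π s₀ m hm F - T.rolloutAffinity P Q π s₀ m hm G := by
  rw [rolloutAffinity, rolloutAffinity, rolloutAffinity, ← sum_sub_distrib]
  exact sum_congr rfl fun τ _ => by ring

/-- If every episode has affinity at least `b`, then `k` episodes have affinity at least `b ^ k`,
whatever the learner does. -/
lemma pow_le_bhatt_law (P Q : T.Kernels) (L : T.Learner) {b : ℝ} (hb : 0 ≤ b)
    (h : ∀ π k, b ≤ bhatt (T.rollout P π (T.init k) H le_rfl)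
      (T.rollout Q π (T.init k) H le_rfl)) (k : ℕ) :
    b ^ k ≤ bhatt (T.law P L k) (T.law Q L k) := by
  induction k with
  | zero => rw [pow_zero, law, law, bhatt_self]
  | succ k ih =>
    -- Policy and trajectory are grouped into one draw given the history, so that the chain rule
    -- applies twice.
    have hlaw : ∀ R : T.Kernels, T.law R L (k + 1) = (T.law R L k).bind fun hist =>
        ((L k hist).bind fun π => (T.rollout R π (T.init k) H le_rfl).map (Prod.mk π)).map
          (Fin.snoc (α := fun _ => T.Episode) hist) := by
      intro R
      rw [law]
      simp only [PMF.map_bind, PMF.map_comp]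
      rfl
    rw [hlaw, hlaw, bhatt_bind_map (fun (hist : Fin k → T.Episode) e =>
      Fin.snoc (α := fun _ => T.Episode) hist e) (bijective_snoc k T.Episode)]
    have hstep : ∀ hist, b ≤ bhatt
        ((L k hist).bind fun π => (T.rollout P π (T.init k) H le_rfl).map (Prod.mk π))
        ((L k hist).bind fun π => (T.rollout Q π (T.init k) H le_rfl).map (Prod.mk π)) := by
      intro hist
      rw [bhatt_bind_map (fun (π : T.Policy) (τ : Fin (H + 1) → T.State) => Prod.mk π τ)
        Function.bijective_id]
      calc b = ∑ π, ((L k hist) π).toReal * b := by rw [← sum_mul, sum_toReal_pmf, one_mul]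
        _ ≤ _ := by
          refine sum_le_sum fun π _ => ?_
          -- The learner is the same under both kernels, so `√L * √L = L` is again a probability.
          rw [Real.mul_self_sqrt ENNReal.toReal_nonneg]
          exact mul_le_mul_of_nonneg_left (h π k) ENNReal.toReal_nonneg
    calc b ^ (k + 1) = b ^ k * b := pow_succ b k
      _ ≤ bhatt (T.law P L k) (T.law Q L k) * b := mul_le_mul_of_nonneg_right ih hb
      _ ≤ _ := by
        rw [bhatt, sum_mul]
        exact sum_le_sum fun hist _ => mul_le_mul_of_nonneg_left (hstep hist) (by positivity)

/-! ### Values and regret -/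

lemma value_last (α : ℝ) (P : T.Kernels) (π : T.Policy) (s : T.State) :
    T.value α P π (Fin.last H) s = 0 := by
  rw [value, Fin.reverseInduction_last]

lemma value_castSucc (α : ℝ) (P : T.Kernels) (π : T.Policy) (h : Fin H) (s : T.State) :
    T.value α P π h.castSucc s =
      T.reward h s (π h s) + cvar α (P h s (π h s)) (T.value α P π h.succ) := by
  rw [value, Fin.reverseInduction_castSucc]
  rfl

lemma value_le_optValue (α : ℝ) (P : T.Kernels) (π : T.Policy) (s : T.State) :
    T.value α P π 0 s ≤ T.optValue α P s :=
  le_ciSup (f := fun π => T.value α P π 0 s) (Set.finite_range _).bddAbove π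

end Task

/-! ### The hard instances -/

/-- The states: a chain of `N + 1` states and three absorbing states. -/
abbrev ChainState (N : ℕ) : Type := Fin (N + 1) ⊕ Fin 3

/-- The actions: sign vectors of length `m`. -/
abbrev SignVec (m : ℕ) : Type := Fin m → ℤˣ

/-- The less favourable successor of a state. -/
def badNext {N : ℕ} : ChainState N → ChainState N
  | .inl i => if h : (i : ℕ) + 1 < N + 1 then .inl ⟨i + 1, h⟩ else .inr 2
  | .inr i => .inr i

/-- The more favourable successor of a state. -/
def goodNext {N : ℕ} : ChainState N → ChainState N
  | .inl i => if (i : ℕ) + 1 < N + 1 then .inr 0 else .inr 1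
  | .inr i => .inr i

/-- The probability of the less favourable successor when the hidden vector is `0`. -/
def baseProb {N : ℕ} (α : ℝ) : ChainState N → ℝ
  | .inl i => if (i : ℕ) + 1 < N + 1 then α else α / 2
  | .inr _ => 0

/-- The indicator of the last state of the chain. -/
def atEnd {N : ℕ} (s : ChainState N) : ℝ := if s = .inl (Fin.last N) then 1 else 0

/-- The rewards of the absorbing states. -/
def absorbReward : Fin 3 → ℝ := ![1, 0.8, 0.2]

/-- The reward of a state. -/
def stateReward {N : ℕ} : ChainState N → ℝ
  | .inl _ => 0
  | .inr i => absorbReward i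

lemma absorbReward_mem (i : Fin 3) : absorbReward i ∈ Set.Icc (0 : ℝ) 1 := by
  fin_cases i <;> norm_num [absorbReward]

lemma stateReward_mem {N : ℕ} (s : ChainState N) : stateReward s ∈ Set.Icc (0 : ℝ) 1 := by
  rcases s with i | i
  · simp [stateReward]
  · exact absorbReward_mem i

lemma baseProb_mem {N : ℕ} {α : ℝ} (hα : α ∈ Set.Ioc (0 : ℝ) 1) (s : ChainState N) :
    baseProb α s ∈ Set.Icc 0 α := by
  have h := hα.1
  rcases s with i | i
  · unfold baseProb
    simp only
    split_ifs <;> constructor <;> linarith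
  · exact ⟨le_rfl, h.le⟩

/-- The correlation of two sign vectors. -/
def corr {m : ℕ} (σ a : SignVec m) : ℝ := ∑ j, ((σ j : ℤ) : ℝ) * ((a j : ℤ) : ℝ)

lemma sign_mul_mem (u v : ℤˣ) :
    ((u : ℤ) : ℝ) * ((v : ℤ) : ℝ) ∈ Set.Icc (-1 : ℝ) 1 := by
  rcases Int.units_eq_one_or u with rfl | rfl <;> rcases Int.units_eq_one_or v with rfl | rfl <;>
    norm_num

lemma sign_sq (u : ℤˣ) : ((u : ℤ) : ℝ) ^ 2 = 1 := by
  rcases Int.units_eq_one_or u with rfl | rfl <;> norm_num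

lemma corr_self {m : ℕ} (σ : SignVec m) : corr σ σ = m := by
  simp [corr, ← sq, sign_sq]

lemma abs_corr_le {m : ℕ} (σ a : SignVec m) : |corr σ a| ≤ m := by
  calc |corr σ a| ≤ ∑ j : Fin m, |((σ j : ℤ) : ℝ) * ((a j : ℤ) : ℝ)| := abs_sum_le_sum_abs _ _
    _ ≤ ∑ _j : Fin m, (1 : ℝ) := sum_le_sum fun j _ => abs_le.2 (sign_mul_mem _ _)
    _ = m := by simp

/-- The probability of the less favourable successor when the hidden vector is `Δ • σ`. -/
def badProb {m N : ℕ} (α Δ : ℝ) (σ : SignVec m) (s : ChainState N) (a : SignVec m) : ℝ :=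
  baseProb α s - atEnd s * (Δ * corr σ a)

lemma badProb_last {m N : ℕ} (α Δ : ℝ) (σ a : SignVec m) :
    badProb α Δ σ (.inl (Fin.last N)) a = α / 2 - Δ * corr σ a := by
  simp [badProb, baseProb, atEnd]

lemma badProb_of_ne {m N : ℕ} (α Δ : ℝ) (σ a : SignVec m) {s : ChainState N}
    (hs : s ≠ .inl (Fin.last N)) : badProb α Δ σ s a = baseProb α s := by
  simp [badProb, atEnd, hs]

lemma badProb_last_mem {m N : ℕ} {α Δ : ℝ} (hΔ : 0 ≤ Δ) (hm : m * Δ ≤ α / 4) (σ a : SignVec m) :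
    badProb α Δ σ (.inl (Fin.last N)) a ∈ Set.Icc (α / 4) (3 * α / 4) := by
  have h := abs_le.1 (abs_corr_le σ a)
  rw [badProb_last]
  constructor <;> nlinarith [mul_le_mul_of_nonneg_left h.1 hΔ, mul_le_mul_of_nonneg_left h.2 hΔ]

lemma badProb_mem {m N : ℕ} {α Δ : ℝ} (hα : α ∈ Set.Ioc (0 : ℝ) 1) (hΔ : 0 ≤ Δ)
    (hm : m * Δ ≤ α / 4) (σ : SignVec m) (s : ChainState N) (a : SignVec m) :
    badProb α Δ σ s a ∈ Set.Icc 0 α := by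
  have h := hα.1
  by_cases hs : s = .inl (Fin.last N)
  · subst hs
    have := badProb_last_mem (N := N) hΔ hm σ a
    constructor <;> linarith [this.1, this.2]
  · rw [badProb_of_ne _ _ _ _ hs]
    exact baseProb_mem hα s

/-- The features of the hard instances. -/
def chainFeature (m N : ℕ) (α : ℝ) (s' s : ChainState N) (a : SignVec m) :
    EuclideanSpace ℝ (Fin (m + 1)) :=
  WithLp.toLp 2 (Fin.cons
    (√3 / 2 * ((if s' = badNext s then baseProb α s else 0) +
      (if s' = goodNext s then 1 - baseProb α s else 0)))
    (fun j => 1 / (2 * √m) * atEnd s * ((a j : ℤ) : ℝ) *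
      ((if s' = goodNext s then 1 else 0) - (if s' = badNext s then 1 else 0))))

/-- The factors `√3 / 2` and `1 / (2 * √m)` split the squared norm: at most `3 / 4` from the first
coordinate and `1 / 4` from the other `m` together. -/
lemma chainFeature_norm_le {m N : ℕ} {α : ℝ} (hm : 1 ≤ m) (hα : α ∈ Set.Ioc (0 : ℝ) 1)
    (f : ChainState N → ℝ) (hf : ∀ s, f s ∈ Set.Icc (0 : ℝ) 1) (s : ChainState N)
    (a : SignVec m) : ‖∑ s', f s' • chainFeature m N α s' s a‖ ≤ 1 := by
  have hm0 : (0 : ℝ) < m := by exact_mod_cast hm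
  have hb := baseProb_mem hα s
  have hb1 : baseProb α s ≤ 1 := hb.2.trans hα.2
  set p := baseProb α s with hp
  set x := f (badNext s) with hx
  set y := f (goodNext s) with hy
  have hx1 := hf (badNext s)
  have hy1 := hf (goodNext s)
  rw [← hx] at hx1
  rw [← hy] at hy1
  have e0 : (∑ s', f s' • chainFeature m N α s' s a) 0 = √3 / 2 * (p * x + (1 - p) * y) := by
    simp only [chainFeature, WithLp.ofLp_sum, WithLp.ofLp_smul, Finset.sum_apply, Pi.smul_apply,
      Fin.cons_zero, smul_eq_mul, ← hp]
    have e : ∀ s', f s' * (√3 / 2 * ((if s' = badNext s then p else 0) +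
        (if s' = goodNext s then 1 - p else 0))) =
        (if s' = badNext s then f s' * (√3 / 2 * p) else 0) +
        (if s' = goodNext s then f s' * (√3 / 2 * (1 - p)) else 0) := by
      intro s'
      split_ifs <;> ring
    rw [sum_congr rfl fun s' _ => e s', sum_add_distrib, sum_ite_eq' univ (badNext s),
      sum_ite_eq' univ (goodNext s), if_pos (mem_univ _), if_pos (mem_univ _)]
    ring
  have ej : ∀ j : Fin m, (∑ s', f s' • chainFeature m N α s' s a) j.succ =
      1 / (2 * √m) * atEnd s * ((a j : ℤ) : ℝ) * (y - x) := by
    intro j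
    simp only [chainFeature, WithLp.ofLp_sum, WithLp.ofLp_smul, Finset.sum_apply, Pi.smul_apply,
      Fin.cons_succ, smul_eq_mul]
    generalize 1 / (2 * √m) * atEnd s * ((a j : ℤ) : ℝ) = c
    have e : ∀ s', f s' * (c * ((if s' = goodNext s then 1 else 0) -
        (if s' = badNext s then 1 else 0))) =
        (if s' = goodNext s then f s' * c else 0) - (if s' = badNext s then f s' * c else 0) := by
      intro s'
      split_ifs <;> ring
    rw [sum_congr rfl fun s' _ => e s', sum_sub_distrib, sum_ite_eq' univ (goodNext s),
      sum_ite_eq' univ (badNext s), if_pos (mem_univ _), if_pos (mem_univ _)]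
    ring
  rw [EuclideanSpace.norm_eq, Real.sqrt_le_one, Fin.sum_univ_succ, e0]
  simp only [ej, Real.norm_eq_abs, sq_abs, mul_pow, sign_sq, div_pow]
  rw [sum_const, card_univ, Fintype.card_fin, nsmul_eq_mul, Real.sq_sqrt (by norm_num),
    Real.sq_sqrt hm0.le]
  have h1 : (p * x + (1 - p) * y) ^ 2 ≤ 1 := by
    have hl : 0 ≤ p * x + (1 - p) * y := by
      have := hb.1
      have := hx1.1
      have := hy1.1
      have : 0 ≤ 1 - p := by linarith
      positivity
    have hu : p * x + (1 - p) * y ≤ 1 := by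
      nlinarith [mul_le_mul_of_nonneg_left hx1.2 hb.1,
        mul_le_mul_of_nonneg_left hy1.2 (sub_nonneg.2 hb1)]
    nlinarith
  have h2 : atEnd s ^ 2 * (y - x) ^ 2 ≤ 1 := by
    have : (y - x) ^ 2 ≤ 1 := by
      have := hx1.1
      have := hx1.2
      have := hy1.1
      have := hy1.2
      rw [sq_le_one_iff_abs_le_one, abs_le]
      constructor <;> linarith
    unfold atEnd
    split_ifs
    · simpa using this
    · simp
  have e : (m : ℝ) * (1 ^ 2 / (2 ^ 2 * m) * atEnd s ^ 2 * 1 * (y - x) ^ 2) =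
      1 / 4 * (atEnd s ^ 2 * (y - x) ^ 2) := by
    field_simp
    ring
  rw [e]
  linarith

/-- What the agent knows about the hard instances. -/
def chainTask (m N H : ℕ) (α : ℝ) (hm : 1 ≤ m) (hα : α ∈ Set.Ioc (0 : ℝ) 1) : Task (m + 1) H where
  State := ChainState N
  Action := SignVec m
  feature := chainFeature m N α
  feature_norm_le := chainFeature_norm_le hm hα
  reward _ s _ := stateReward s
  reward_mem _ s _ := stateReward_mem s
  init _ := .inl 0

section

variable {m N H : ℕ} {α Δ : ℝ} (hm : 1 ≤ m) (hα : α ∈ Set.Ioc (0 : ℝ) 1) (hΔ : 0 < Δ)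
  (hmΔ : m * Δ ≤ α / 4)

/-- The transition kernel of the hard instance with hidden vector `Δ • σ`. -/
def chainStep (hα : α ∈ Set.Ioc (0 : ℝ) 1) (hΔ : 0 < Δ) (hmΔ : m * Δ ≤ α / 4) (σ : SignVec m)
    (s : ChainState N) (a : SignVec m) : PMF (ChainState N) :=
  twoPoint (badProb α Δ σ s a)
    ⟨(badProb_mem hα hΔ.le hmΔ σ s a).1, (badProb_mem hα hΔ.le hmΔ σ s a).2.trans hα.2⟩
    (badNext s) (goodNext s)

/-- The kernels of the hard instance with hidden vector `Δ • σ`. -/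
def chainKernels (H : ℕ) (hm : 1 ≤ m) (hα : α ∈ Set.Ioc (0 : ℝ) 1) (hΔ : 0 < Δ)
    (hmΔ : m * Δ ≤ α / 4) (σ : SignVec m) : (chainTask m N H α hm hα).Kernels :=
  fun _ s a => chainStep hα hΔ hmΔ σ s a

lemma chainStep_toReal (σ : SignVec m) (s s' : ChainState N) (a : SignVec m) :
    (chainStep hα hΔ hmΔ σ s a s').toReal =
      (if s' = badNext s then badProb α Δ σ s a else 0) +
        (if s' = goodNext s then 1 - badProb α Δ σ s a else 0) :=
  twoPoint_toReal _ _ _ _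

lemma isLinearMixture_chainKernels (σ : SignVec m) :
    (chainTask m N H α hm hα).IsLinearMixture (chainKernels H hm hα hΔ hmΔ σ) := by
  intro h
  have hm1 : (1 : ℝ) ≤ m := by exact_mod_cast hm
  have hm0 : (0 : ℝ) < m := by linarith
  -- `θ` undoes the scaling of the features. Its squared norm is `4 / 3 + 4 * (m * Δ) ^ 2 ≤ 4 / 3 +
  -- 1 / 4`, which is below `2 ≤ m + 1`.
  refine ⟨WithLp.toLp 2 (Fin.cons (2 / √3) fun j => Δ * ((σ j : ℤ) : ℝ) * (2 * √m)), ?_, ?_⟩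
  · rw [EuclideanSpace.norm_eq]
    apply Real.sqrt_le_sqrt
    rw [Fin.sum_univ_succ]
    simp only [Fin.cons_zero, Fin.cons_succ, Real.norm_eq_abs, sq_abs, mul_pow, sign_sq, div_pow]
    rw [sum_const, card_univ, Fintype.card_fin, nsmul_eq_mul, Real.sq_sqrt (by norm_num),
      Real.sq_sqrt hm0.le]
    have : ((m : ℝ) * Δ) ^ 2 ≤ (1 / 4) ^ 2 := by
      have := hα.2
      gcongr
      linarith
    push_cast
    nlinarith
  · intro (s' : ChainState N) (s : ChainState N) (a : SignVec m)
    change (chainStep hα hΔ hmΔ σ s a s').toReal = inner ℝ _ (chainFeature m N α s' s a)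
    rw [chainStep_toReal, PiLp.inner_apply, Fin.sum_univ_succ]
    simp only [chainFeature, Fin.cons_zero, Fin.cons_succ, RCLike.inner_apply, conj_trivial]
    have h3 : √3 / 2 * (2 / √3) = 1 := by
      have : √(3 : ℝ) ≠ 0 := by positivity
      field_simp
    have hmm : 1 / (2 * √m) * (2 * √m) = 1 := by
      have : √(m : ℝ) ≠ 0 := by positivity
      field_simp
    have e : ∀ g b : ℝ, ∑ j, 1 / (2 * √m) * atEnd s * ((a j : ℤ) : ℝ) * (g - b) *
        (Δ * ((σ j : ℤ) : ℝ) * (2 * √m)) = atEnd s * (Δ * corr σ a) * (g - b) := by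
      intro g b
      rw [corr, mul_sum, mul_sum, sum_mul]
      refine sum_congr rfl fun j _ => ?_
      linear_combination (atEnd s * ((a j : ℤ) : ℝ) * (g - b) * (Δ * ((σ j : ℤ) : ℝ))) * hmm
    rw [e, badProb]
    generalize baseProb α s = p
    generalize atEnd s * (Δ * corr σ a) = t
    have e2 : ∀ w : ℝ, √3 / 2 * w * (2 / √3) = w := fun w => by linear_combination w * h3
    rw [e2]
    split_ifs <;> ring

/-- The hard instances have the required shape. -/
def chainBandit (σ : SignVec m) :
    (chainTask m N H α hm hα).ChainBandit (chainKernels H hm hα hΔ hmΔ σ) (N + 1) α where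
  chain := Sum.inl
  absorb := Sum.inr
  bijective_states := by
    have h : Function.Bijective
        (Sum.elim Sum.inl Sum.inr : Fin (N + 1) ⊕ Fin 3 → ChainState N) := by
      rw [Sum.elim_inl_inr]
      exact Function.bijective_id
    exact h
  sign := Equiv.refl _
  Δ := Δ
  Δ_pos := hΔ
  μ := fun j => Δ * ((σ j : ℤ) : ℝ)
  μ_eq := fun i => by
    rcases Int.units_eq_one_or (σ i) with h | h <;> rw [h] <;> simp
  q := α / 2
  q_le := by
    have := hα.1
    push_cast
    linarith
  init_eq := fun k i hi => by
    have : i = 0 := Fin.ext hi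
    subst this
    rfl
  reward_chain _ _ _ := rfl
  reward_absorb _ _ := ⟨rfl, rfl, rfl⟩
  trans_chain := fun h (a : SignVec m) i j hij => by
    have hi : (i : ℕ) + 1 < N + 1 := hij ▸ j.2
    have hne : (Sum.inl i : ChainState N) ≠ .inl (Fin.last N) := by
      intro h
      have := congrArg Fin.val (Sum.inl_injective h)
      simp only [Fin.val_last] at this
      omega
    have hj : j = ⟨i + 1, hi⟩ := Fin.ext hij
    change (chainStep hα hΔ hmΔ σ (.inl i) a (.inl j)).toReal = α ∧
      (chainStep hα hΔ hmΔ σ (.inl i) a (.inr 0)).toReal = 1 - α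
    simp only [chainStep_toReal, badProb_of_ne _ _ _ _ hne, badNext, goodNext, baseProb]
    simp [hi, hj]
  trans_last := fun h (a : SignVec m) i hi => by
    have hl : i = Fin.last N := Fin.ext (by simpa using hi)
    subst hl
    have e : (∑ j, Δ * ((σ j : ℤ) : ℝ) * ((a j : ℤ) : ℝ)) = Δ * corr σ a := by
      rw [corr, mul_sum]
      exact sum_congr rfl fun j _ => mul_assoc _ _ _
    change (chainStep hα hΔ hmΔ σ (.inl (Fin.last N)) a (.inr 2)).toReal =
        α / 2 - (∑ j, Δ * ((σ j : ℤ) : ℝ) * ((a j : ℤ) : ℝ)) ∧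
      (chainStep hα hΔ hmΔ σ (.inl (Fin.last N)) a (.inr 1)).toReal =
        1 - (α / 2 - (∑ j, Δ * ((σ j : ℤ) : ℝ) * ((a j : ℤ) : ℝ)))
    rw [e]
    simp [chainStep_toReal, badProb_last, badNext, goodNext]
  trans_absorb := fun h (a : SignVec m) i => by
    change (chainStep hα hΔ hmΔ σ (.inr i) a (.inr i)).toReal = 1
    simp [chainStep_toReal, badNext, goodNext]

/-! ### The values of the hard instances -/

/-- The value functions of a policy in the hard instance. -/
def chainValue (σ : SignVec m) (π : Fin H → ChainState N → SignVec m) (h : Fin (H + 1)) :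
    ChainState N → ℝ :=
  (chainTask m N H α hm hα).value α (chainKernels H hm hα hΔ hmΔ σ) π h

lemma chainValue_last (σ : SignVec m) (π : Fin H → ChainState N → SignVec m) (s : ChainState N) :
    chainValue hm hα hΔ hmΔ σ π (Fin.last H) s = 0 :=
  Task.value_last _ _ _ _ _

/-- The bad probability never exceeds `α`, so the linear formula for the CVaR is available once the
two successors are known to be ordered by value. -/
lemma chainValue_castSucc (σ : SignVec m) (π : Fin H → ChainState N → SignVec m) (h : Fin H)
    (s : ChainState N)
    (hV : chainValue hm hα hΔ hmΔ σ π h.succ (badNext s) ≤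
      chainValue hm hα hΔ hmΔ σ π h.succ (goodNext s)) :
    chainValue hm hα hΔ hmΔ σ π h.castSucc s = stateReward s +
      (chainValue hm hα hΔ hmΔ σ π h.succ (goodNext s) - badProb α Δ σ s (π h s) / α *
        (chainValue hm hα hΔ hmΔ σ π h.succ (goodNext s) -
          chainValue hm hα hΔ hmΔ σ π h.succ (badNext s))) := by
  have hb := badProb_mem hα hΔ.le hmΔ σ s (π h s)
  rw [← cvar_twoPoint hα.1 hα.2 ⟨hb.1, hb.2.trans hα.2⟩ hb.2 _ _ _ hV]
  exact Task.value_castSucc _ _ _ _ _ _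

lemma chainValue_absorb (σ : SignVec m) (π : Fin H → ChainState N → SignVec m) (h : Fin (H + 1))
    (i : Fin 3) :
    chainValue hm hα hΔ hmΔ σ π h (.inr i) = ((H : ℝ) - (h : ℕ)) * absorbReward i := by
  induction h using Fin.reverseInduction with
  | last => rw [chainValue_last]; simp
  | cast h ih =>
    rw [chainValue_castSucc _ _ _ _ _ _ _ _ le_rfl]
    simp only [badNext, goodNext, stateReward, ih, sub_self, mul_zero, sub_zero, Fin.val_succ,
      Fin.val_castSucc]
    push_cast
    ring

/-- The value of the first chain state depends only on the action in the last chain state. -/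
lemma chainValue_chain (hN : N < H) (σ : SignVec m) (π : Fin H → ChainState N → SignVec m) :
    chainValue hm hα hΔ hmΔ σ π 0 (.inl 0) =
      ((H : ℝ) - N - 1) * (0.8 - 0.6 / α *
        badProb α Δ σ (.inl (Fin.last N) : ChainState N) (π ⟨N, hN⟩ (.inl (Fin.last N)))) := by
  set p := badProb α Δ σ (.inl (Fin.last N) : ChainState N) (π ⟨N, hN⟩ (.inl (Fin.last N)))
    with hp
  have hp0 : 0 ≤ p := (badProb_mem hα hΔ.le hmΔ σ _ _).1
  have hα0 := hα.1
  have hNH : (N : ℝ) + 1 ≤ H := by exact_mod_cast hN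
  -- Backward induction on the distance `j` to the end. Only state `i` at time `i` matters, as the
  -- chain is entered at its start and never waits.
  have key : ∀ j i : ℕ, (hi : i + j = N) →
      chainValue hm hα hΔ hmΔ σ π ⟨i, by omega⟩ (.inl ⟨i, by omega⟩) =
      ((H : ℝ) - N - 1) * (0.8 - 0.6 / α * p) := by
    intro j
    induction j with
    | zero =>
      intro i hi
      obtain rfl : i = N := by omega
      have hb : badNext (.inl (Fin.last i) : ChainState i) = .inr 2 := by simp [badNext]
      have hg : goodNext (.inl (Fin.last i) : ChainState i) = .inr 1 := by simp [goodNext]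
      have h := chainValue_castSucc hm hα hΔ hmΔ σ π ⟨i, hN⟩ (.inl (Fin.last i))
      rw [hb, hg, chainValue_absorb, chainValue_absorb, ← hp] at h
      refine (h ?_).trans ?_
      · refine mul_le_mul_of_nonneg_left
          (show (0.2 : ℝ) ≤ 0.8 by norm_num) ?_
        simp only [Fin.val_succ]
        push_cast
        linarith
      · simp only [Fin.val_succ, absorbReward, stateReward, Matrix.cons_val]
        push_cast
        field_simp
        ring
    | succ j ih =>
      intro i hi
      have hiH : i < H := by omega
      have hi1 : i < N + 1 := by omega
      have hlt : i + 1 < N + 1 := by omega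
      have hne : (.inl ⟨i, hi1⟩ : ChainState N) ≠ .inl (Fin.last N) := by
        intro h
        have := congrArg Fin.val (Sum.inl_injective h)
        simp only [Fin.val_last] at this
        omega
      have hb : badNext (.inl ⟨i, hi1⟩ : ChainState N) = .inl ⟨i + 1, hlt⟩ := by
        simp [badNext, hlt]
      have hg : goodNext (.inl ⟨i, hi1⟩ : ChainState N) = .inr 0 := by simp [goodNext, hlt]
      have hbase : baseProb α (.inl ⟨i, hi1⟩ : ChainState N) = α := by simp [baseProb, hlt]
      have hih := ih (i + 1) (by omega)
      have h := chainValue_castSucc hm hα hΔ hmΔ σ π ⟨i, hiH⟩ (.inl ⟨i, hi1⟩)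
      rw [hb, hg, badProb_of_ne _ _ _ _ hne, hbase, div_self hα0.ne', one_mul, sub_sub_cancel,
        stateReward, zero_add] at h
      refine (h ?_).trans hih
      -- The order of the successors: the end of the chain is worth at most `0.8 * (H - N - 1)`,
      -- less than the reward `1` collected in `x_1` for all remaining steps.
      refine hih.le.trans ?_
      rw [chainValue_absorb]
      have hiN : (i : ℝ) + 1 ≤ N := by exact_mod_cast (by omega : i + 1 ≤ N)
      simp only [Fin.val_succ, absorbReward, Matrix.cons_val_zero, mul_one]
      push_cast
      have : 0 ≤ 0.6 / α * p := by positivity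
      nlinarith
  exact key N 0 (by omega)

end

section

variable {m N H : ℕ} {α Δ : ℝ} (hm : 1 ≤ m) (hα : α ∈ Set.Ioc (0 : ℝ) 1) (hΔ : 0 < Δ)
  (hmΔ : m * Δ ≤ α / 4)

/-! ### Affinity of the episodes of two hard instances -/

lemma sqrt_chainStep_zero (σ σ' : SignVec m) (s : ChainState N) (a : SignVec m) :
    √(chainStep hα hΔ hmΔ σ s a (.inl 0)).toReal *
      √(chainStep hα hΔ hmΔ σ' s a (.inl 0)).toReal = 0 := by
  rcases s with k | k
  · by_cases hk : (k : ℕ) + 1 < N + 1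
    · have : (0 : Fin (N + 1)) ≠ ⟨k + 1, hk⟩ := fun h => by simpa using congrArg Fin.val h
      simp [chainStep_toReal, badNext, goodNext, hk, this]
    · simp [chainStep_toReal, badNext, goodNext, hk]
  · simp [chainStep_toReal, badNext, goodNext]

/-- The next chain state is entered only from its predecessor, where the hidden vector plays no
role, so both square roots are `√α`. -/
lemma sqrt_chainStep_succ (σ σ' : SignVec m) (s : ChainState N) (a : SignVec m) (i : Fin N) :
    √(chainStep hα hΔ hmΔ σ s a (.inl i.succ)).toReal *
      √(chainStep hα hΔ hmΔ σ' s a (.inl i.succ)).toReal =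
      α * if s = .inl i.castSucc then 1 else 0 := by
  rcases s with k | k
  · by_cases hk : (k : ℕ) + 1 < N + 1
    · have hne : (.inl k : ChainState N) ≠ .inl (Fin.last N) := by
        intro h
        have := congrArg Fin.val (Sum.inl_injective h)
        simp only [Fin.val_last] at this
        omega
      have he : i.succ = ⟨k + 1, hk⟩ ↔ k = i.castSucc := by
        rw [Fin.ext_iff, Fin.ext_iff]
        simp [eq_comm]
      simp only [chainStep_toReal, badProb_of_ne _ _ _ _ hne]
      by_cases hki : k = i.castSucc
      · simp [badNext, goodNext, baseProb, he.2 hki, hki, Real.mul_self_sqrt hα.1.le]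
      · simp [badNext, goodNext, hk, hki, he]
    · have : k ≠ i.castSucc := by
        rintro rfl
        have := i.2
        simp only [Fin.val_castSucc] at hk
        omega
      simp [chainStep_toReal, badNext, goodNext, hk, this]
  · simp [chainStep_toReal, badNext, goodNext]

/-- Only the last chain state sees the hidden vector. There both bad probabilities lie in `[α / 4, 3
* α / 4]` and differ by `2 * Δ`, so `bhatt_twoPoint_ge` with `c = α / 4` gives the loss. -/
lemma bhatt_chainStep_ge (σ σ' : SignVec m) (hσ : ∀ a, (corr σ a - corr σ' a) ^ 2 = 4)
    (s : ChainState N) (a : SignVec m) :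
    1 - 4 * Δ ^ 2 / α * (if s = .inl (Fin.last N) then 1 else 0) ≤
      bhatt (chainStep hα hΔ hmΔ σ s a) (chainStep hα hΔ hmΔ σ' s a) := by
  have hα0 := hα.1
  have hα1 := hα.2
  by_cases hs : s = .inl (Fin.last N)
  · subst hs
    have h1 := badProb_last_mem (N := N) hΔ.le hmΔ σ a
    have h2 := badProb_last_mem (N := N) hΔ.le hmΔ σ' a
    have hne : badNext (.inl (Fin.last N) : ChainState N) ≠ goodNext (.inl (Fin.last N)) := by
      simp [badNext, goodNext]
    have h := bhatt_twoPoint_ge (c := α / 4)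
      ⟨by linarith [h1.1], by linarith [h1.2]⟩ ⟨by linarith [h2.1], by linarith [h2.2]⟩
      (by linarith) ⟨h1.1, by linarith [h1.2]⟩ ⟨h2.1, by linarith [h2.2]⟩ hne
    refine le_trans (le_of_eq ?_) h
    rw [if_pos rfl, badProb_last, badProb_last]
    have e : (α / 2 - Δ * corr σ a - (α / 2 - Δ * corr σ' a)) ^ 2 = 4 * Δ ^ 2 := by
      linear_combination Δ ^ 2 * hσ a
    rw [e]
    field_simp
  · have : chainStep hα hΔ hmΔ σ s a = chainStep hα hΔ hmΔ σ' s a := by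
      simp only [chainStep, badProb_of_ne _ _ _ _ hs]
    rw [this, bhatt_self, if_neg hs]
    simp

/-- `Task.rolloutAffinity` for two hard instances. -/
def chainAffinity (σ σ' : SignVec m) (π : Fin H → ChainState N → SignVec m) (l : ℕ) (hl : l ≤ H)
    (F : ChainState N → ℝ) : ℝ :=
  (chainTask m N H α hm hα).rolloutAffinity (chainKernels H hm hα hΔ hmΔ σ)
    (chainKernels H hm hα hΔ hmΔ σ') π (.inl 0 : ChainState N) l hl F

lemma chainAffinity_succ (σ σ' : SignVec m) (π : Fin H → ChainState N → SignVec m) (l : ℕ)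
    (hl : l + 1 ≤ H) (F : ChainState N → ℝ) :
    chainAffinity hm hα hΔ hmΔ σ σ' π (l + 1) hl F =
      chainAffinity hm hα hΔ hmΔ σ σ' π l (Nat.le_of_succ_le hl) fun s =>
        ∑ s', √(chainStep hα hΔ hmΔ σ s (π ⟨l, hl⟩ s) s').toReal *
          √(chainStep hα hΔ hmΔ σ' s (π ⟨l, hl⟩ s) s').toReal * F s' :=
  Task.rolloutAffinity_succ _ _ _ _ _ _ _ _

/-- The chain state `i` can only be visited at time `i`, with probability `α ^ i`. -/
lemma chainAffinity_indicator (σ σ' : SignVec m) (π : Fin H → ChainState N → SignVec m) (l : ℕ)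
    (hl : l ≤ H) (i : Fin (N + 1)) :
    chainAffinity hm hα hΔ hmΔ σ σ' π l hl (fun s => if s = .inl i then 1 else 0) =
      if l = i then α ^ l else 0 := by
  induction l generalizing i with
  | zero =>
    refine (Task.rolloutAffinity_zero _ _ _ _ _ _).trans ?_
    simp [Fin.ext_iff]
  | succ l ih =>
    rw [chainAffinity_succ]
    simp only [mul_ite, mul_one, mul_zero, sum_ite_eq', mem_univ, if_true]
    refine Fin.cases ?_ (fun i => ?_) i
    · simp only [sqrt_chainStep_zero]
      have h := Task.rolloutAffinity_mul (chainTask m N H α hm hα) (chainKernels H hm hα hΔ hmΔ σ)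
        (chainKernels H hm hα hΔ hmΔ σ') π (.inl 0 : ChainState N) l (Nat.le_of_succ_le hl) 0
        (fun _ => 0)
      simp only [zero_mul] at h
      exact h.trans (by simp)
    · simp only [sqrt_chainStep_succ]
      refine (Task.rolloutAffinity_mul _ _ _ _ _ _ _ _ _).trans ?_
      refine (congrArg (α * ·) (ih (Nat.le_of_succ_le hl) i.castSucc)).trans ?_
      simp only [Fin.val_castSucc, Fin.val_succ, add_left_inj]
      split_ifs
      · ring
      · simp

/-- Affinity is lost only in the step from time `N` to `N + 1`, the one time at which the end of the
chain can be occupied, and there with weight `α ^ N`. -/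
lemma chainAffinity_one_ge (σ σ' : SignVec m) (hσ : ∀ a, (corr σ a - corr σ' a) ^ 2 = 4)
    (π : Fin H → ChainState N → SignVec m) (l : ℕ) (hl : l ≤ H) :
    1 - 4 * Δ ^ 2 / α * (if N < l then α ^ N else 0) ≤
      chainAffinity hm hα hΔ hmΔ σ σ' π l hl (fun _ => 1) := by
  induction l with
  | zero =>
    refine le_trans (by simp) (Task.rolloutAffinity_zero _ _ _ _ _ _).ge
  | succ l ih =>
    rw [chainAffinity_succ]
    have hmono := Task.rolloutAffinity_mono (chainTask m N H α hm hα)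
      (chainKernels H hm hα hΔ hmΔ σ) (chainKernels H hm hα hΔ hmΔ σ') π
      (.inl 0 : ChainState N) l (Nat.le_of_succ_le hl)
      (fun s => bhatt_chainStep_ge hα hΔ hmΔ σ σ' hσ s (π ⟨l, hl⟩ s))
    have hsub := (Task.rolloutAffinity_sub (chainTask m N H α hm hα)
      (chainKernels H hm hα hΔ hmΔ σ) (chainKernels H hm hα hΔ hmΔ σ') π
      (.inl 0 : ChainState N) l (Nat.le_of_succ_le hl) (fun _ => 1)
      (fun s : ChainState N => 4 * Δ ^ 2 / α * (if s = .inl (Fin.last N) then 1 else 0))).trans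
      (congrArg _ ((Task.rolloutAffinity_mul _ _ _ _ _ _ _ _ _).trans
        (congrArg (4 * Δ ^ 2 / α * ·) (chainAffinity_indicator hm hα hΔ hmΔ σ σ' π l
          (Nat.le_of_succ_le hl) (Fin.last N)))))
    have h := hsub.symm.le.trans hmono
    simp only [mul_one]
    refine le_trans (le_trans ?_ (sub_le_sub_right (ih (Nat.le_of_succ_le hl)) _)) h
    simp only [Fin.val_last]
    apply le_of_eq
    rcases lt_trichotomy l N with h | rfl | h
    · rw [if_neg (by omega), if_neg (by omega), if_neg (by omega)]
      ring
    · rw [if_pos (by omega), if_neg (by omega), if_pos rfl]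
      ring
    · rw [if_pos (by omega), if_pos (by omega), if_neg (by omega)]
      ring

lemma bhatt_law_ge (hN : N < H) (σ σ' : SignVec m)
    (hσ : ∀ a, (corr σ a - corr σ' a) ^ 2 = 4) (L : (chainTask m N H α hm hα).Learner)
    (hsmall : 4 * Δ ^ 2 / α * α ^ N ≤ 1) (K : ℕ) :
    1 - K * (4 * Δ ^ 2 / α * α ^ N) ≤
      bhatt ((chainTask m N H α hm hα).law (chainKernels H hm hα hΔ hmΔ σ) L K)
        ((chainTask m N H α hm hα).law (chainKernels H hm hα hΔ hmΔ σ') L K) := by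
  have hb : ∀ π k, 1 - 4 * Δ ^ 2 / α * α ^ N ≤
      bhatt ((chainTask m N H α hm hα).rollout (chainKernels H hm hα hΔ hmΔ σ) π
        ((chainTask m N H α hm hα).init k) H le_rfl)
      ((chainTask m N H α hm hα).rollout (chainKernels H hm hα hΔ hmΔ σ') π
        ((chainTask m N H α hm hα).init k) H le_rfl) := by
    intro π k
    have h := chainAffinity_one_ge hm hα hΔ hmΔ σ σ' hσ π H le_rfl
    rw [if_pos hN] at h
    exact h.trans (Task.rolloutAffinity_one _ _ _ _ _ _ _).le
  refine le_trans ?_ (Task.pow_le_bhatt_law _ _ _ L (by linarith) hb K)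
  have h := one_add_mul_le_pow (a := -(4 * Δ ^ 2 / α * α ^ N)) (by linarith) K
  calc _ = 1 + (K : ℝ) * -(4 * Δ ^ 2 / α * α ^ N) := by ring
    _ ≤ _ := h
    _ = _ := by ring

/-! ### The regret counts the wrong signs -/

/-- The action of episode `k` in the last state of the chain. -/
def endAction (hN : N < H) {K : ℕ} (ω : Fin K → (chainTask m N H α hm hα).Episode) (k : Fin K) :
    SignVec m :=
  (ω k).1 ⟨N, hN⟩ (.inl (Fin.last N) : ChainState N)

/-- The number of episodes in which the sign of coordinate `j` is wrong. -/
def wrongSigns (hN : N < H) {K : ℕ} (σ : SignVec m) (j : Fin m)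
    (ω : Fin K → (chainTask m N H α hm hα).Episode) : ℝ :=
  ∑ k, (1 - ((σ j : ℤ) : ℝ) * ((endAction hm hα hN ω k j : ℤ) : ℝ)) / 2

lemma wrongSigns_mem (hN : N < H) {K : ℕ} (σ : SignVec m) (j : Fin m)
    (ω : Fin K → (chainTask m N H α hm hα).Episode) :
    wrongSigns hm hα hN σ j ω ∈ Set.Icc (0 : ℝ) K := by
  have h := fun k => sign_mul_mem (σ j) (endAction hm hα hN ω k j)
  constructor
  · exact sum_nonneg fun k _ => by linarith [(h k).2]
  · calc wrongSigns hm hα hN σ j ω ≤ ∑ _k : Fin K, (1 : ℝ) :=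
          sum_le_sum fun k _ => by linarith [(h k).1]
      _ = K := by simp

/-- Reverse the sign of coordinate `j`. -/
def flipSign (j : Fin m) (σ : SignVec m) : SignVec m := Function.update σ j (-σ j)

lemma flipSign_involutive (j : Fin m) : Function.Involutive (flipSign j) := by
  intro σ
  simp [flipSign]

/-- The difference is `±2` whatever the action: no choice of the learner makes an episode more
informative about a sign. -/
lemma corr_sub_corr_flipSign (j : Fin m) (σ a : SignVec m) :
    (corr σ a - corr (flipSign j σ) a) ^ 2 = 4 := by
  have h : corr σ a - corr (flipSign j σ) a = 2 * (((σ j : ℤ) : ℝ) * ((a j : ℤ) : ℝ)) := by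
    rw [corr, corr, ← sum_sub_distrib, sum_eq_single j]
    · simp [flipSign]
      ring
    · intro i _ hi
      simp [flipSign, hi]
    · simp
  rw [h, mul_pow, mul_pow, sign_sq, sign_sq]
  norm_num

lemma wrongSigns_flipSign (hN : N < H) {K : ℕ} (σ : SignVec m) (j : Fin m)
    (ω : Fin K → (chainTask m N H α hm hα).Episode) :
    wrongSigns hm hα hN (flipSign j σ) j ω = K - wrongSigns hm hα hN σ j ω := by
  rw [eq_sub_iff_add_eq, wrongSigns, wrongSigns, ← sum_add_distrib]
  calc _ = ∑ _k : Fin K, (1 : ℝ) := sum_congr rfl fun k _ => by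
          simp only [flipSign, Function.update_self, Units.val_neg, Int.cast_neg]
          ring
    _ = K := by simp

/-- The comparator always plays `σ`. Values are affine in the correlation with `σ`, which falls
short of `m` by twice the number of wrong signs. -/
lemma chain_regret_ge (hN : N < H) {K : ℕ} (σ : SignVec m)
    (ω : Fin K → (chainTask m N H α hm hα).Episode) :
    ((H : ℝ) - N - 1) * (0.6 / α) * Δ * 2 * ∑ j, wrongSigns hm hα hN σ j ω ≤
      (chainTask m N H α hm hα).regret α (chainKernels H hm hα hΔ hmΔ σ) ω := by
  have e : ∑ j, wrongSigns hm hα hN σ j ω =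
      ∑ k, ((m : ℝ) - corr σ (endAction hm hα hN ω k)) / 2 := by
    simp only [wrongSigns]
    rw [sum_comm]
    refine sum_congr rfl fun k _ => ?_
    rw [← sum_div, sum_sub_distrib, corr]
    simp
  rw [e, mul_sum]
  refine sum_le_sum fun k _ => ?_
  have hbest : chainValue hm hα hΔ hmΔ σ (fun _ _ => σ) 0 (.inl 0) ≤
      (chainTask m N H α hm hα).optValue α (chainKernels H hm hα hΔ hmΔ σ)
        ((chainTask m N H α hm hα).init k) :=
    Task.value_le_optValue _ _ _ _ _
  refine le_trans (le_of_eq ?_) (sub_le_sub_right hbest _)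
  have h1 := chainValue_chain hm hα hΔ hmΔ hN σ fun _ _ => σ
  have h2 : chainValue hm hα hΔ hmΔ σ (ω k).1 0 (.inl 0) = ((H : ℝ) - N - 1) * (0.8 - 0.6 / α *
      badProb α Δ σ (.inl (Fin.last N) : ChainState N) (endAction hm hα hN ω k)) :=
    chainValue_chain hm hα hΔ hmΔ hN σ (ω k).1
  refine Eq.trans ?_ (congrArg₂ (· - ·) h1 h2).symm
  simp only [badProb_last, corr_self]
  ring

lemma chain_expectedRegret_ge (hN : N < H) (K : ℕ) (σ : SignVec m)
    (L : (chainTask m N H α hm hα).Learner) :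
    ((H : ℝ) - N - 1) * (0.6 / α) * Δ * 2 *
        ∑ j, ∑ ω, ((chainTask m N H α hm hα).law (chainKernels H hm hα hΔ hmΔ σ) L K ω).toReal *
          wrongSigns hm hα hN σ j ω ≤
      (chainTask m N H α hm hα).expectedRegret α (chainKernels H hm hα hΔ hmΔ σ) L K := by
  rw [sum_comm, mul_sum, Task.expectedRegret]
  refine sum_le_sum fun ω _ => ?_
  rw [← mul_sum]
  calc _ = ((chainTask m N H α hm hα).law (chainKernels H hm hα hΔ hmΔ σ) L K ω).toReal *
        (((H : ℝ) - N - 1) * (0.6 / α) * Δ * 2 * ∑ j, wrongSigns hm hα hN σ j ω) := by ring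
    _ ≤ _ := mul_le_mul_of_nonneg_left (chain_regret_ge hm hα hΔ hmΔ hN σ ω)
        ENNReal.toReal_nonneg

/-- Some hidden vector makes the learner err in a constant fraction of all signs. -/
lemma exists_many_wrongSigns (hN : N < H) (K : ℕ) (L : (chainTask m N H α hm hα).Learner)
    (hsmall : 4 * Δ ^ 2 / α * α ^ N ≤ 1) (hK : K * (4 * Δ ^ 2 / α * α ^ N) ≤ 1 / 4) :
    ∃ σ : SignVec m, (m : ℝ) * (K / 8) ≤
      ∑ j, ∑ ω, ((chainTask m N H α hm hα).law (chainKernels H hm hα hΔ hmΔ σ) L K ω).toReal *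
        wrongSigns hm hα hN σ j ω := by
  set W : Fin m → SignVec m → ℝ := fun j σ =>
    ∑ ω, ((chainTask m N H α hm hα).law (chainKernels H hm hα hΔ hmΔ σ) L K ω).toReal *
      wrongSigns hm hα hN σ j ω with hW
  have hpair : ∀ j σ, (K : ℝ) / 4 ≤ W j σ + W j (flipSign j σ) := by
    intro j σ
    have hb := bhatt_law_ge hm hα hΔ hmΔ hN σ (flipSign j σ) (corr_sub_corr_flipSign j σ) L
      hsmall K
    have h := two_point_bound
      ((chainTask m N H α hm hα).law (chainKernels H hm hα hΔ hmΔ σ) L K)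
      ((chainTask m N H α hm hα).law (chainKernels H hm hα hΔ hmΔ (flipSign j σ)) L K)
      (wrongSigns hm hα hN σ j) K (wrongSigns_mem hm hα hN σ j) (Nat.cast_nonneg K)
    simp only [← wrongSigns_flipSign] at h
    refine le_trans ?_ h
    -- The affinity is at least `1 - 1 / 4`, and `(K / 2) * (9 / 16) ≥ K / 4`.
    have : (3 / 4 : ℝ) ^ 2 ≤ bhatt
        ((chainTask m N H α hm hα).law (chainKernels H hm hα hΔ hmΔ σ) L K)
        ((chainTask m N H α hm hα).law (chainKernels H hm hα hΔ hmΔ (flipSign j σ)) L K) ^ 2 := by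
      gcongr
      linarith
    nlinarith [(Nat.cast_nonneg K : (0 : ℝ) ≤ K)]
  -- Flipping permutes the hidden vectors, so summing `hpair` counts each of them twice.
  have havg : ∀ j, ∑ _σ : SignVec m, (K : ℝ) / 8 ≤ ∑ σ, W j σ := by
    intro j
    have h := sum_le_sum fun σ (_ : σ ∈ (univ : Finset (SignVec m))) => hpair j σ
    rw [sum_add_distrib, (flipSign_involutive j).bijective.sum_comp (W j)] at h
    have e : ∑ _σ : SignVec m, (K : ℝ) / 4 = 2 * ∑ _σ : SignVec m, (K : ℝ) / 8 := by
      rw [mul_sum]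
      exact sum_congr rfl fun _ _ => by ring
    linarith
  have htot : ∑ _σ : SignVec m, (m : ℝ) * (K / 8) ≤ ∑ σ, ∑ j, W j σ := by
    rw [sum_comm (f := fun σ j => W j σ)]
    calc _ = ∑ _j : Fin m, ∑ _σ : SignVec m, (K : ℝ) / 8 := by
          rw [sum_const, sum_const, sum_const, nsmul_eq_mul, nsmul_eq_mul, nsmul_eq_mul]
          simp
          ring
      _ ≤ _ := sum_le_sum fun j _ => havg j
  obtain ⟨σ, _, h⟩ := exists_le_of_sum_le univ_nonempty htot
  exact ⟨σ, h⟩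

end

end ICVaR

end

/-! ### / Choice of the gap and the final constant -/

theorem theorem2 :
    ∃ c : ℝ, 0 < c ∧ ∀ (H d n K : ℕ) (α : ℝ), 2 ≤ H → 2 ≤ d → 1 ≤ n → n ≤ H - 1 →
      0 < α → α ≤ 1 → (d : ℝ) ^ 2 / α ^ n ≤ (K : ℝ) →
      ∀ alg : ICVaR.Algorithm d H, ∃ (T : ICVaR.Task d H) (P : T.Kernels),
        T.IsLinearMixture P ∧ Nonempty (T.ChainBandit P n α) ∧
        c * ((d : ℝ) * ((H : ℝ) - (n : ℝ)) * √((K : ℝ) / α ^ n)) ≤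
          T.expectedRegret α P (alg T) K := by
  refine ⟨1 / 100, by norm_num, ?_⟩
  intro H d n K α hH hd hn hnH hα0 hα1 hdK alg
  obtain ⟨m, rfl⟩ : ∃ m, d = m + 1 := ⟨d - 1, by omega⟩
  obtain ⟨N, rfl⟩ : ∃ N, n = N + 1 := ⟨n - 1, by omega⟩
  have hm : 1 ≤ m := by omega
  have hm1 : (1 : ℝ) ≤ m := by exact_mod_cast hm
  have hN : N < H := by omega
  have hNH : (N : ℝ) + 1 ≤ H := by exact_mod_cast hN
  have hα : α ∈ Set.Ioc (0 : ℝ) 1 := ⟨hα0, hα1⟩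
  have hpow : 0 < α ^ (N + 1) := by positivity
  have hK2 : ((m : ℝ) + 1) ^ 2 ≤ K * α ^ (N + 1) := by
    rw [div_le_iff₀ hpow] at hdK
    exact_mod_cast hdK
  have hKpos : (0 : ℝ) < K := by
    by_contra h
    have : (K : ℝ) * α ^ (N + 1) ≤ 0 := mul_nonpos_of_nonpos_of_nonneg (not_lt.1 h) hpow.le
    nlinarith
  -- The assumption on `K` says `R ≥ d`. This makes the gap `Δ = α / (4 * R)` small enough for `m *
  -- Δ ≤ α / 4`, and `hdelta` shows that this gap costs exactly `1 / 4` of affinity over `K`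
  -- episodes.
  set R := √((K : ℝ) * α ^ (N + 1)) with hR
  have hR2 : R ^ 2 = K * α ^ (N + 1) := Real.sq_sqrt (by positivity)
  have hRm : (m : ℝ) + 1 ≤ R := Real.le_sqrt_of_sq_le hK2
  have hR0 : 0 < R := by linarith
  have hsqrt : √((K : ℝ) / α ^ (N + 1)) = K / R := by
    rw [Real.sqrt_eq_iff_mul_self_eq_of_pos (by positivity), ← sq, div_pow, hR2]
    field_simp
  have hΔ : 0 < α / (4 * R) := by positivity
  have hmΔ : m * (α / (4 * R)) ≤ α / 4 := by
    rw [mul_div_assoc', div_le_div_iff₀ (by positivity) (by norm_num)]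
    nlinarith
  have hdelta : K * (4 * (α / (4 * R)) ^ 2 / α * α ^ N) = 1 / 4 := by
    have : (4 * (α / (4 * R)) ^ 2 / α * α ^ N) = α ^ (N + 1) / (4 * R ^ 2) := by
      field_simp
      ring
    rw [this, hR2]
    field_simp
  have hsmall : 4 * (α / (4 * R)) ^ 2 / α * α ^ N ≤ 1 := by
    have hK1 : (1 : ℝ) ≤ K := by exact_mod_cast (Nat.cast_pos.1 hKpos)
    have : 0 ≤ 4 * (α / (4 * R)) ^ 2 / α * α ^ N := by positivity
    nlinarith
  obtain ⟨σ, hσ⟩ := ICVaR.exists_many_wrongSigns hm hα hΔ hmΔ hN K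
    (alg (ICVaR.chainTask m N H α hm hα)) hsmall hdelta.le
  refine ⟨ICVaR.chainTask m N H α hm hα, ICVaR.chainKernels H hm hα hΔ hmΔ σ,
    ICVaR.isLinearMixture_chainKernels hm hα hΔ hmΔ σ, ⟨ICVaR.chainBandit hm hα hΔ hmΔ σ⟩, ?_⟩
  refine le_trans ?_ (ICVaR.chain_expectedRegret_ge hm hα hΔ hmΔ hN K σ _)
  have hg : 0 ≤ (H : ℝ) - N - 1 := by linarith
  refine le_trans ?_ (mul_le_mul_of_nonneg_left hσ (by positivity))
  rw [hsqrt]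
  have e1 : ((H : ℝ) - N - 1) * (0.6 / α) * (α / (4 * R)) * 2 * (m * (K / 8)) =
      0.0375 * m * (((H : ℝ) - N - 1) * (K / R)) := by
    field_simp
    ring
  rw [e1]
  have e2 : (1 / 100 : ℝ) * (((m + 1 : ℕ) : ℝ) * ((H : ℝ) - ((N + 1 : ℕ) : ℝ)) * (K / R)) =
      1 / 100 * (m + 1) * (((H : ℝ) - N - 1) * (K / R)) := by
    push_cast
    ring
  rw [e2]
  refine mul_le_mul_of_nonneg_right ?_ (by positivity)
  -- `m + 1 ≤ 2 * m`, and `2 / 100 ≤ 0.0375`.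
  linarith
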